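/- Solitaire Clobber is played with black and white stones, at most one per square, on a checkerboard. A move of White (resp. Black) picks up a white (resp. black) stone and places it on a horizontally or vertically adjacent square that carries a stone of the opposite color; that stone is removed and replaced by the moved stone. A configuration is $k$-reducible if, by a finite sequence of moves in which the two colors alternate and White moves first, one can reach a position with exactly $k$ stones, none of which can move. A rectangular checkerboard configuration with $n$ rows and $m$ columns is one in which the stones occupy exactly the squares of an $n\times m$ rectangle and every stone has the color of its square; if $nm$ is odd, we assume that there is one white stone fewer than there are black stones. Theorem. Let $n,m\ge 2$. A rectangular checkerboard configuration with $n$ rows and $m$ columns is $1$-reducible if $nm\not\equiv 0 \pmod 3$. If $nm\equiv 0\pmod 3$, then it is $2$-reducible but not $1$-reducible; in this case it cannot be reduced to a single stone even if the moves of the two colors need not alternate. -/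

import Mathlib

namespace Clobber

/-- The two colors, of stones, of squares, and of the players. -/
inductive Color where
  | black
  | white
  deriving DecidableEq

/-- The opposite color. -/
def Color.other : Color → Color
  | black => white
  | white => black

/-- A square of the (unbounded) board, as a pair (row, column). -/
abbrev Square := ℤ × ℤ

/-- The color of a square of the underlying checkerboard. Rectangles below may lie anywhere, so
fixing which squares are black is no loss of generality. -/
def squareColor (p : Square) : Color :=
  if Even (p.1 + p.2) then Color.black else Color.white

/-- Horizontally or vertically adjacent squares. -/
def Adjacent (p q : Square) : Prop :=
  |p.1 - q.1| + |p.2 - q.2| = 1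

/-- A configuration: every square is empty (`none`) or carries one stone. -/
abbrev Config := Square → Option Color

/-- The set of squares that carry a stone. -/
def stones (C : Config) : Set Square := {p | C p ≠ none}

/-- The set of squares that carry a stone of color `c`. -/
def stonesOf (c : Color) (C : Config) : Set Square := {p | C p = some c}

/-- `D` arises from `C` by one move of player `c`: a stone of color `c` clobbers a stone of the
other color on an adjacent square, which it replaces. -/
def Move (c : Color) (C D : Config) : Prop :=
  ∃ p q : Square, Adjacent p q ∧ C p = some c ∧ C q = some c.other ∧
    D = Function.update (Function.update C p none) q (some c)

/-- `Alternating c C D`: one gets from `C` to `D` by a finite sequence of moves in which the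
players alternate and player `c` makes the first move. -/
inductive Alternating : Color → Config → Config → Prop
  | refl (c : Color) (C : Config) : Alternating c C C
  | step {c : Color} {C D E : Config} :
      Move c C D → Alternating c.other D E → Alternating c C E

/-- `D` is reachable from `C` by a finite sequence of moves of either player, in any order. -/
def Reachable : Config → Config → Prop :=
  Relation.ReflTransGen fun C D => ∃ c, Move c C D

/-- All stones of `C` are immovable. -/
def Stuck (C : Config) : Prop := ∀ (c : Color) (D : Config), ¬ Move c C D

/-- `C` is `k`-reducible: by alternating moves, White moving first, one can end up with exactly
`k` stones, all immovable. -/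
def Reducible (C : Config) (k : ℕ) : Prop :=
  ∃ D, Alternating Color.white C D ∧ Stuck D ∧ (stones D).encard = k

/-- The same with the moves of the two colors in arbitrary order. -/
def FreelyReducible (C : Config) (k : ℕ) : Prop :=
  ∃ D, Reachable C D ∧ Stuck D ∧ (stones D).encard = k

/-- All stones are matching: each has the color of its square. -/
def IsCheckerboard (C : Config) : Prop :=
  ∀ (p : Square) (c : Color), C p = some c → c = squareColor p

/-- The stones occupy exactly the squares of some rectangle with `n` rows and `m` columns. -/
def IsRectangular (n m : ℕ) (C : Config) : Prop :=
  ∃ a b : ℤ, stones C = {p | (a ≤ p.1 ∧ p.1 < a + n) ∧ (b ≤ p.2 ∧ p.2 < b + m)}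

end Clobber

namespace Clobber

/-! Apart from whose turn it is, all that matters is whether each stone matches its square. Adjacent
squares have opposite colors, so a stone can clobber a neighbor exactly when both match or both
clash, and the moving stone flips its state. Give matching stones weight 1 and clashing stones
weight 2: since 1 + 1 = 2 and 2 + 2 = 1 modulo 3, no move of either player changes the total weight
modulo 3 (`sum_weight_of_move`). A checkerboard of nm stones has weight nm and a single stone has
nonzero weight, which excludes one stone when 3 divides nm (`not_freelyReducible_one`).

The reductions are explicit. If both sides are at least 3, three rows are cleared at a time. An
opening leaves a `trail`, one matching and one clashing stone in the same column; it advances two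
columns at a time and is absorbed near the last column together with three stones of the rows below.
What remains is, up to symmetry, a rectangle with a `notch`, which can be cleared in the same way,
by rows or by columns. If 3 divides neither side, this ends at boards with sides 4 and 5, for which
plays are given. If 3 divides a side, it ends at three rows, where the trail itself is the final
pair. Two-row boards are eaten from both ends at once, three columns at each
(`CanReduce.ends_of_ends`).

Each move removes one stone, so the number of removed stones determines who moves next; the parities
in the statements record this. Plays in small boxes are verified by computation (`checkPlay`) and
transported by symmetries (`play_of_checkPlay`). -/

/-- A position recorded relative to the colors of the squares: `some true` is a matching stone,
`some false` a clashing one. -/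
abbrev Board := Square → Option Bool

/-- The parity of an integer; `true` for odd. -/
def parity (z : ℤ) : Bool := decide (z % 2 = 1)

/-- The color (white is `true`) of a stone on `p` that matches its square iff `b`. -/
def colorBit (p : Square) (b : Bool) : Bool := xor (parity (p.1 + p.2)) (!b)

/-- The board after the stone on `p` has clobbered the one on `q`. -/
def Board.clobber (R : Board) (p q : Square) : Board :=
  Function.update (Function.update R p none) q ((R q).map (!·))

/-- Player `x` can clobber the stone on `q` with the one on `p`. Adjacent stones have opposite colors
if and only if both match or both clash. -/
def CanClobber (x : Bool) (R : Board) (p q : Square) : Prop :=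
  Adjacent p q ∧ ∃ b, R p = some b ∧ R q = some b ∧ colorBit p b = x

/-- `Play x R y S`: alternating moves lead from `R`, with player `x` to move, to `S`, with
player `y` to move. -/
inductive Play : Bool → Board → Bool → Board → Prop
  | refl (x : Bool) (R : Board) : Play x R x R
  | step {x y : Bool} {R S : Board} {p q : Square} :
      CanClobber x R p q → Play (!x) (R.clobber p q) y S → Play x R y S

theorem Play.trans {x y z : Bool} {R S T : Board} (h : Play x R y S) (h' : Play y S z T) :
    Play x R z T := by
  induction h with
  | refl => exact h'
  | step hc _ ih => exact .step hc (ih h')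

/-- `e` is a symmetry of the grid that shifts the colors of the squares by `ε`. -/
structure IsSymmetry (e : Square ≃ Square) (ε : Bool) : Prop where
  adjacent : ∀ {p q}, Adjacent p q → Adjacent (e p) (e q)
  parity : ∀ p, parity ((e p).1 + (e p).2) = xor (parity (p.1 + p.2)) ε

theorem IsSymmetry.colorBit {e : Square ≃ Square} {ε : Bool} (he : IsSymmetry e ε) (p : Square)
    (b : Bool) : colorBit (e p) b = xor (colorBit p b) ε := by
  simp only [Clobber.colorBit, he.parity]
  cases Clobber.parity (p.1 + p.2) <;> cases b <;> cases ε <;> rfl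

/-- Symmetries of the grid carry plays to plays. -/
theorem Play.map {x y : Bool} {R S : Board} (h : Play x R y S) {e : Square ≃ Square} {ε : Bool}
    (he : IsSymmetry e ε) : Play (xor x ε) (R ∘ e.symm) (xor y ε) (S ∘ e.symm) := by
  induction h with
  | refl x R => exact .refl _ _
  | @step x y R S p q hc hp ih =>
    obtain ⟨hadj, b, hb, hb', hx⟩ := hc
    refine .step (p := e p) (q := e q) ⟨he.adjacent hadj, b, ?_, ?_, ?_⟩ ?_
    · simpa using hb
    · simpa using hb'
    · rw [he.colorBit, hx]
    · have h1 : (!(xor x ε)) = xor (!x) ε := by cases x <;> cases ε <;> rfl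
      -- States are relative to the squares, so clobbering commutes with the symmetry even if it
      -- exchanges the colors; only the player changes.
      have h2 : (Board.clobber (R ∘ e.symm) (e p) (e q) : Board) = R.clobber p q ∘ e.symm := by
        funext r
        obtain ⟨r, rfl⟩ := e.surjective r
        simp [Board.clobber, Function.update_apply]
      rw [h1, h2]
      exact ih

/-! ### Checking concrete plays -/

/-- A move on a board with nonnegative coordinates: row and column of the stone that moves, then
row and column of the stone that it clobbers. -/
abbrev Ply := ℕ × ℕ × ℕ × ℕ

/-- The square that the move leaves. -/
def Ply.src (a : Ply) : Square := (a.1, a.2.1)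

/-- The square that the move enters. -/
def Ply.dst (a : Ply) : Square := (a.2.2.1, a.2.2.2)

/-- Whether the move is horizontal or vertical by one square. -/
def Ply.isUnit : Ply → Bool
  | (i, j, k, l) => (i == k && (j + 1 == l || l + 1 == j)) || (j == l && (i + 1 == k || k + 1 == i))

/-- Whether the moves are legal, alternate, start with player `x`, stay in the `h × w` box and
lead from `R` to a board that agrees with `S` in this box, with player `y` to move. -/
def checkPlay (h w : ℕ) (S : Board) (y : Bool) : List Ply → Bool → Board → Bool
  | [], x, R => x == y && (List.range h).all fun i => (List.range w).all fun j =>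
      R (i, j) == S (i, j)
  | a :: l, x, R => a.isUnit && decide (a.1 < h) && decide (a.2.1 < w) && decide (a.2.2.1 < h) &&
      decide (a.2.2.2 < w) && (match R a.src with
        | none => false
        | some b => R a.dst == some b && colorBit a.src b == x) &&
      checkPlay h w S y l (!x) (R.clobber a.src a.dst)

/-- Membership in the `h × w` box at the origin. -/
def InBox (h w : ℕ) (p : Square) : Prop := 0 ≤ p.1 ∧ p.1 < h ∧ 0 ≤ p.2 ∧ p.2 < w

theorem Ply.adjacent {a : Ply} (ha : a.isUnit = true) : Adjacent a.src a.dst := by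
  obtain ⟨i, j, k, l⟩ := a
  simp only [Ply.isUnit, Bool.or_eq_true, Bool.and_eq_true, beq_iff_eq] at ha
  simp only [Adjacent, Ply.src, Ply.dst]
  have h1 : |(i : ℤ) - k| = max ((i : ℤ) - k) (k - i) := by rw [abs_eq_max_neg]; ring_nf
  have h2 : |(j : ℤ) - l| = max ((j : ℤ) - l) (l - j) := by rw [abs_eq_max_neg]; ring_nf
  rw [h1, h2]
  omega

/-- A checked play in a box can be carried out, up to a symmetry, on any board that looks like
`R` in the box. -/
theorem play_of_checkPlay {h w : ℕ} {S : Board} {y : Bool} (l : List Ply) {x : Bool} {R : Board}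
    (hc : checkPlay h w S y l x R = true) {e : Square ≃ Square} {ε : Bool} (he : IsSymmetry e ε)
    {A B : Board} (hA : ∀ p, InBox h w p → A (e p) = R p)
    (hB : ∀ p, InBox h w p → B (e p) = S p)
    (hAB : ∀ p, ¬ InBox h w p → B (e p) = A (e p)) :
    Play (xor x ε) A (xor y ε) B := by
  induction l generalizing x R A with
  | nil =>
    simp only [checkPlay, Bool.and_eq_true, beq_iff_eq, List.all_eq_true, List.mem_range] at hc
    obtain ⟨rfl, hc⟩ := hc
    have : A = B := by
      funext p
      obtain ⟨p, rfl⟩ := e.surjective p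
      by_cases hp : InBox h w p
      · rw [hA p hp, hB p hp]
        obtain ⟨i, j⟩ := p
        obtain ⟨h1, h2, h3, h4⟩ := hp
        have := hc i.toNat (by simp only at h1 h2; omega) j.toNat (by simp only at h3 h4; omega)
        simpa [Int.toNat_of_nonneg h1, Int.toNat_of_nonneg h3] using this
      · rw [hAB p hp]
    rw [this]
    exact .refl _ _
  | cons a l ih =>
    simp only [checkPlay, Bool.and_eq_true, decide_eq_true_eq] at hc
    obtain ⟨⟨⟨⟨⟨⟨hu, h1⟩, h2⟩, h3⟩, h4⟩, hm⟩, hl⟩ := hc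
    have hsrc : InBox h w a.src := by
      simp only [InBox, Ply.src]
      omega
    have hdst : InBox h w a.dst := by
      simp only [InBox, Ply.dst]
      omega
    refine .step (p := e a.src) (q := e a.dst) ⟨he.adjacent (Ply.adjacent hu), ?_⟩ ?_
    · cases hR : R a.src with
      | none => simp [hR] at hm
      | some b =>
        simp only [hR, Bool.and_eq_true, beq_iff_eq] at hm
        refine ⟨b, ?_, ?_, ?_⟩
        · rw [hA _ hsrc, hR]
        · rw [hA _ hdst, hm.1]
        · rw [he.colorBit, hm.2]
    · have hx : (!(xor x ε)) = xor (!x) ε := by cases x <;> cases ε <;> rfl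
      rw [hx]
      refine ih hl ?_ ?_
      · intro p hp
        simp [Board.clobber, Function.update_apply, hA p hp, hA _ hdst]
      · intro p hp
        have n1 : p ≠ a.src := by
          rintro rfl
          exact hp hsrc
        have n2 : p ≠ a.dst := by
          rintro rfl
          exact hp hdst
        simp [Board.clobber, n1, n2, hAB p hp]

theorem IsSymmetry.refl : IsSymmetry (Equiv.refl Square) false :=
  ⟨fun h => h, fun p => by simp⟩

/-! ### Outcomes -/

/-- A board with exactly `k` stones none of which can move. -/
def IsTerminal (k : ℕ) (R : Board) : Prop :=
  {p | R p ≠ none}.encard = k ∧ ∀ p q b, Adjacent p q → R p = some b → R q ≠ some b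

/-- With player `x` to move, alternating moves can reduce `R` to `k` stones. -/
def CanReduce (k : ℕ) (x : Bool) (R : Board) : Prop :=
  ∃ y S, Play x R y S ∧ IsTerminal k S

theorem CanReduce.of_play {k : ℕ} {x y : Bool} {R S : Board} (h : CanReduce k y S)
    (hp : Play x R y S) : CanReduce k x R := by
  obtain ⟨z, T, hT, ht⟩ := h
  exact ⟨z, T, hp.trans hT, ht⟩

theorem IsTerminal.canReduce {k : ℕ} {x : Bool} {R : Board} (h : IsTerminal k R) :
    CanReduce k x R := ⟨x, R, .refl _ _, h⟩

theorem IsTerminal.map {k : ℕ} {R : Board} (h : IsTerminal k R) {e : Square ≃ Square}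
    {ε : Bool} (he : IsSymmetry e.symm ε) : IsTerminal k (R ∘ e.symm) := by
  refine ⟨?_, fun p q b hpq => h.2 _ _ b (he.adjacent hpq)⟩
  have : {p | (R ∘ e.symm) p ≠ none} = e '' {p | R p ≠ none} := by
    rw [Equiv.image_eq_preimage_symm]
    rfl
  rw [this, e.injective.encard_image, h.1]

theorem CanReduce.map {k : ℕ} {x : Bool} {R : Board} (h : CanReduce k x R) {e : Square ≃ Square}
    {ε ε' : Bool} (he : IsSymmetry e ε) (he' : IsSymmetry e.symm ε') {A : Board}
    (hA : ∀ p, A (e p) = R p) : CanReduce k (xor x ε) A := by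
  obtain ⟨y, S, hp, ht⟩ := h
  have : A = R ∘ e.symm := by
    funext p
    obtain ⟨p, rfl⟩ := e.surjective p
    simp [hA]
  exact ⟨_, _, this ▸ hp.map he, ht.map he'⟩

theorem isTerminal_one (a : Square) (b : Bool) :
    IsTerminal 1 (fun p => if p = a then some b else none) := by
  constructor
  · have : {p : Square | (if p = a then some b else none) ≠ none} = {a} := by
      ext p
      simp
    rw [this]
    simp
  · intro p q c hpq hp hq
    have h1 : p = a := by
      by_contra h
      simp [h] at hp
    have h2 : q = a := by
      by_contra h
      simp [h] at hq
    subst h1 h2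
    simp [Adjacent] at hpq

theorem isTerminal_two {a a' : Square} {b b' : Bool} (h : a ≠ a') (ha : ¬ Adjacent a a')
    (ha' : ¬ Adjacent a' a) :
    IsTerminal 2 (fun p => if p = a then some b else if p = a' then some b' else none) := by
  constructor
  · have : {p : Square | (if p = a then some b else if p = a' then some b' else none) ≠ none} =
        {a, a'} := by
      ext p
      by_cases h1 : p = a
      · simp [h1]
      · by_cases h2 : p = a'
        · subst h2
          simp [h1]
        · simp [h1, h2]
    rw [this, Set.encard_pair h]
    rfl
  · intro p q c hpq hp hq
    have h0 : ∀ p, (if p = a then some b else if p = a' then some b' else none) = some c →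
        p = a ∨ p = a' := by
      intro p hp
      by_contra! h
      simp [h.1, h.2] at hp
    rcases h0 p hp with rfl | rfl <;> rcases h0 q hq with rfl | rfl
    · simp [Adjacent] at hpq
    · exact ha hpq
    · exact ha' hpq
    · simp [Adjacent] at hpq

/-! ### Symmetries of the grid -/

/-- The translation by `(a, b)`. -/
def shift (a b : ℤ) : Square ≃ Square where
  toFun p := (p.1 + a, p.2 + b)
  invFun p := (p.1 - a, p.2 - b)
  left_inv p := by simp
  right_inv p := by simp

/-- The reflection of columns that exchanges the columns `0` and `c`, followed by a translation of
the rows by `a`. -/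
def mirror (a c : ℤ) : Square ≃ Square where
  toFun p := (p.1 + a, c - p.2)
  invFun p := (p.1 - a, c - p.2)
  left_inv p := by simp
  right_inv p := by simp

/-- The half-turn that exchanges `(0, 0)` and `(a, c)`. -/
def halfTurn (a c : ℤ) : Square ≃ Square where
  toFun p := (a - p.1, c - p.2)
  invFun p := (a - p.1, c - p.2)
  left_inv p := by simp
  right_inv p := by simp

/-- The exchange of rows and columns. -/
def transposition : Square ≃ Square := Equiv.prodComm ℤ ℤ

theorem parity_eq_xor_iff {x y : ℤ} {ε : Bool} :
    parity x = xor (parity y) ε ↔ (x - y) % 2 = if ε then 1 else 0 := by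
  by_cases h : x % 2 = 1 <;> by_cases h' : y % 2 = 1 <;> cases ε <;> simp [parity, h, h'] <;> omega

theorem isSymmetry_shift (a b : ℤ) : IsSymmetry (shift a b) (parity (a + b)) where
  adjacent := by simp [Adjacent, shift]
  parity p := by
    rw [parity_eq_xor_iff]
    simp only [shift, Equiv.coe_fn_mk, Clobber.parity, decide_eq_true_eq]
    split_ifs <;> omega

theorem isSymmetry_mirror (a c : ℤ) : IsSymmetry (mirror a c) (parity (a + c)) where
  adjacent {p q} h := by
    rw [Adjacent, abs_sub_comm p.2 q.2] at h
    simpa [Adjacent, mirror] using h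
  parity p := by
    rw [parity_eq_xor_iff]
    simp only [mirror, Equiv.coe_fn_mk, Clobber.parity, decide_eq_true_eq]
    split_ifs <;> omega

theorem isSymmetry_halfTurn (a c : ℤ) : IsSymmetry (halfTurn a c) (parity (a + c)) where
  adjacent {p q} h := by
    rw [Adjacent, abs_sub_comm p.2 q.2, abs_sub_comm p.1 q.1] at h
    simpa [Adjacent, halfTurn] using h
  parity p := by
    rw [parity_eq_xor_iff]
    simp only [halfTurn, Equiv.coe_fn_mk, Clobber.parity, decide_eq_true_eq]
    split_ifs <;> omega

theorem isSymmetry_transposition : IsSymmetry transposition false where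
  adjacent {p q} h := by
    rw [Adjacent, add_comm] at h
    exact h
  parity p := by
    rw [parity_eq_xor_iff]
    simp [transposition, add_comm]

theorem isSymmetry_shift_symm (a b : ℤ) : ∃ ε, IsSymmetry (shift a b).symm ε := by
  refine ⟨parity (-a + -b), ?_⟩
  have : (shift a b).symm = shift (-a) (-b) := by
    ext p <;> simp [shift, sub_eq_add_neg]
  rw [this]
  exact isSymmetry_shift _ _

theorem isSymmetry_mirror_symm (a c : ℤ) : ∃ ε, IsSymmetry (mirror a c).symm ε := by
  refine ⟨parity (-a + c), ?_⟩
  have : (mirror a c).symm = mirror (-a) c := by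
    ext p <;> simp [mirror, sub_eq_add_neg]
  rw [this]
  exact isSymmetry_mirror _ _

theorem CanReduce.mirror {k : ℕ} {x : Bool} {R A : Board} (h : CanReduce k x R) (a c : ℤ)
    (hA : ∀ i j, A (i + a, c - j) = R (i, j)) : CanReduce k (xor x (parity (a + c))) A :=
  h.map (isSymmetry_mirror a c) (isSymmetry_mirror_symm a c).choose_spec fun p => hA p.1 p.2

theorem CanReduce.halfTurn {k : ℕ} {x : Bool} {R A : Board} (h : CanReduce k x R) (a c : ℤ)
    (hA : ∀ i j, A (a - i, c - j) = R (i, j)) : CanReduce k (xor x (parity (a + c))) A :=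
  h.map (isSymmetry_halfTurn a c) (ε' := parity (a + c)) (isSymmetry_halfTurn a c)
    fun p => hA p.1 p.2

theorem CanReduce.shift {k : ℕ} {x : Bool} {R A : Board} (h : CanReduce k x R) (a c : ℤ)
    (hA : ∀ i j, A (i + a, j + c) = R (i, j)) : CanReduce k (xor x (parity (a + c))) A :=
  h.map (isSymmetry_shift a c) (isSymmetry_shift_symm a c).choose_spec fun p => hA p.1 p.2

theorem CanReduce.transpose {k : ℕ} {x : Bool} {R A : Board} (h : CanReduce k x R)
    (hA : ∀ i j, A (j, i) = R (i, j)) : CanReduce k x A := by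
  simpa using h.map isSymmetry_transposition (ε' := false) isSymmetry_transposition
    fun p => hA p.1 p.2

/-! ### Clearing three rows -/

/-- The `n × m` rectangle of matching stones. -/
def rect (n m : ℤ) : Board := fun p =>
  if 0 ≤ p.1 ∧ p.1 < n ∧ 0 ≤ p.2 ∧ p.2 < m then some true else none

/-- The rectangle without the squares `(0, 0)`, `(1, 0)` and `(1, 1)`. -/
def notch (n m : ℤ) : Board := fun p =>
  if 0 ≤ p.1 ∧ p.1 < n ∧ 0 ≤ p.2 ∧ p.2 < m ∧ ¬ (p.1 = 0 ∧ p.2 = 0) ∧ ¬ (p.1 = 1 ∧ p.2 ≤ 1)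
  then some true else none

/-- The rectangle after the first three rows have been cleared up to column `j`, where they leave
two stones, one matching and one clashing. The stone in row `0` is matching if `b` is `true`. -/
def trail (b : Bool) (n m j : ℤ) : Board := fun p =>
  if 0 ≤ p.1 ∧ p.1 < n ∧ 0 ≤ p.2 ∧ p.2 < m ∧ (3 ≤ p.1 ∨ j < p.2) then some true
  else if p = (0, j) then some b else if p = (2, j) then some (!b) else none

/-- The rectangle without the first three rows, with a notch at the last column. -/
def clearedNotch (n m : ℤ) : Board := fun p =>
  if 3 ≤ p.1 ∧ p.1 < n ∧ 0 ≤ p.2 ∧ p.2 < m ∧ ¬ (p.1 = 3 ∧ p.2 = m - 1) ∧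
    ¬ (p.1 = 4 ∧ m - 2 ≤ p.2) then some true else none

/-- The rectangle without the first three rows, with a transposed notch at the last column. -/
def clearedNotchTranspose (n m : ℤ) : Board := fun p =>
  if 3 ≤ p.1 ∧ p.1 < n ∧ 0 ≤ p.2 ∧ p.2 < m ∧ ¬ (p.1 = 3 ∧ m - 2 ≤ p.2) ∧
    ¬ (p.1 = 4 ∧ p.2 = m - 2) then some true else none

/-- A play in the corner box at the origin. -/
theorem play_at_origin {h w : ℕ} {R S A B : Board} {x y : Bool} (l : List Ply)
    (hc : checkPlay h w S y l x R = true) (hA : ∀ p, InBox h w p → A p = R p)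
    (hB : ∀ p, InBox h w p → B p = S p) (hAB : ∀ p, ¬ InBox h w p → B p = A p) :
    Play x A y B := by
  simpa using play_of_checkPlay l hc IsSymmetry.refl hA hB hAB

/-- A play in the box that starts at column `j` of row `0`. -/
theorem play_at_column {h w : ℕ} {R S A B : Board} {x y : Bool} (j : ℤ) (l : List Ply)
    (hc : checkPlay h w S y l x R = true) (hA : ∀ p, InBox h w p → A (p.1, p.2 + j) = R p)
    (hB : ∀ p, InBox h w p → B (p.1, p.2 + j) = S p)
    (hAB : ∀ p, ¬ InBox h w p → B (p.1, p.2 + j) = A (p.1, p.2 + j)) :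
    Play (xor x (parity j)) A (xor y (parity j)) B := by
  simpa using play_of_checkPlay l hc (isSymmetry_shift 0 j) (A := A) (B := B)
    (fun p hp => by simpa [shift] using hA p hp) (fun p hp => by simpa [shift] using hB p hp)
    (fun p hp => by simpa [shift] using hAB p hp)

/-! ### Explicit plays that extend, start and absorb a trail -/

/-- The six moves remove two columns of three stones. Their number is even, and so is the shift by
two columns, so the same player is again to move in the same pattern. -/
theorem play_trail_false {n m j : ℤ} (hn : 3 ≤ n) (hj : 0 ≤ j) (hm : j + 2 < m) :
    Play (parity j) (trail false n m j) (parity j) (trail false n m (j + 2)) := by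
  have h := play_at_column j (h := 3) (w := 3) (R := trail false 3 3 0)
    (S := trail false 3 3 2) (x := false) (y := false)
    [(1, 1, 0, 1), (0, 0, 0, 1), (2, 0, 2, 1), (1, 2, 2, 2), (2, 1, 2, 2), (0, 1, 0, 2)]
    (by decide +kernel)
    (A := trail false n m j) (B := trail false n m (j + 2)) ?_ ?_ ?_
  · simpa using h
  all_goals
    rintro ⟨i, k⟩ hp
    simp only [InBox] at hp
    simp only [trail, Prod.mk.injEq]
    split_ifs <;> first | rfl | (exfalso; omega)

theorem play_trail_true {n m j : ℤ} (hn : 3 ≤ n) (hj : 0 ≤ j) (hm : j + 2 < m) :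
    Play (parity j) (trail true n m j) (parity j) (trail true n m (j + 2)) := by
  have h := play_at_column j (h := 3) (w := 3) (R := trail true 3 3 0)
    (S := trail true 3 3 2) (x := false) (y := false)
    [(0, 0, 0, 1), (1, 2, 0, 2), (1, 1, 2, 1), (2, 0, 2, 1), (0, 1, 0, 2), (2, 1, 2, 2)]
    (by decide +kernel)
    (A := trail true n m j) (B := trail true n m (j + 2)) ?_ ?_ ?_
  · simpa using h
  all_goals
    rintro ⟨i, k⟩ hp
    simp only [InBox] at hp
    simp only [trail, Prod.mk.injEq]
    split_ifs <;> first | rfl | (exfalso; omega)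

/-- Reaching a trail in column `j` takes `3 * j + 1` moves, so after White's start the player to
move is `parity j`. As trails advance by two columns, one opening is needed for each parity of `j`.
-/
theorem play_rect_trail_one {n m : ℤ} (hn : 3 ≤ n) (hm : 2 ≤ m) :
    Play true (rect n m) true (trail false n m 1) := by
  have h := play_at_origin (h := 3) (w := 2) (R := rect 3 2)
    (S := trail false 3 2 1) (x := true) (y := true)
    [(1, 0, 1, 1), (2, 0, 2, 1), (1, 1, 2, 1), (0, 0, 0, 1)]
    (by decide +kernel)
    (A := rect n m) (B := trail false n m 1) ?_ ?_ ?_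
  · simpa using h
  all_goals
    rintro ⟨i, k⟩ hp
    simp only [InBox] at hp
    simp only [rect, trail, Prod.mk.injEq]
    split_ifs <;> first | rfl | (exfalso; omega)

theorem play_rect_trail_two {n m : ℤ} (hn : 3 ≤ n) (hm : 3 ≤ m) :
    Play true (rect n m) false (trail false n m 2) := by
  have h := play_at_origin (h := 3) (w := 3) (R := rect 3 3)
    (S := trail false 3 3 2) (x := true) (y := false)
    [(1, 0, 1, 1), (0, 0, 0, 1), (1, 1, 0, 1), (2, 0, 2, 1), (1, 2, 2, 2), (2, 1, 2, 2),
      (0, 1, 0, 2)]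
    (by decide +kernel)
    (A := rect n m) (B := trail false n m 2) ?_ ?_ ?_
  · simpa using h
  all_goals
    rintro ⟨i, k⟩ hp
    simp only [InBox] at hp
    simp only [rect, trail, Prod.mk.injEq]
    split_ifs <;> first | rfl | (exfalso; omega)

/-- The notch leaves three stones in the first two columns of the strip, and a single move turns
them into a trail. Here the clashing stone is in row `2`, which is why both kinds of trail are
needed. -/
theorem play_notch_trail_one {n m : ℤ} (hn : 3 ≤ n) (hm : 2 ≤ m) :
    Play false (notch n m) true (trail true n m 1) := by
  have h := play_at_origin (h := 3) (w := 2) (R := notch 3 2)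
    (S := trail true 3 2 1) (x := false) (y := true)
    [(2, 0, 2, 1)]
    (by decide +kernel)
    (A := notch n m) (B := trail true n m 1) ?_ ?_ ?_
  · simpa using h
  all_goals
    rintro ⟨i, k⟩ hp
    simp only [InBox] at hp
    simp only [notch, trail, Prod.mk.injEq]
    split_ifs <;> first | rfl | (exfalso; omega)

theorem play_notch_trail_two {n m : ℤ} (hn : 3 ≤ n) (hm : 3 ≤ m) :
    Play false (notch n m) false (trail false n m 2) := by
  have h := play_at_origin (h := 3) (w := 3) (R := notch 3 3)
    (S := trail false 3 3 2) (x := false) (y := false)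
    [(2, 0, 2, 1), (1, 2, 2, 2), (2, 1, 2, 2), (0, 1, 0, 2)]
    (by decide +kernel)
    (A := notch n m) (B := trail false n m 2) ?_ ?_ ?_
  · simpa using h
  all_goals
    rintro ⟨i, k⟩ hp
    simp only [InBox] at hp
    simp only [notch, trail, Prod.mk.injEq]
    split_ifs <;> first | rfl | (exfalso; omega)

/-- The eleven stones left in the strip disappear together with three stones of rows `3` and `4`.
The last two moves flip the stone on `(3, m - 2)` twice, so that everything that remains matches. -/
theorem play_trail_false_clearedNotch {n m : ℤ} (hn : 5 ≤ n) (hm : 4 ≤ m) :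
    Play (parity (m - 4)) (trail false n m (m - 4)) (parity (m - 4)) (clearedNotch n m) := by
  have h := play_at_column (m - 4) (h := 5) (w := 4) (R := trail false 5 4 0)
    (S := clearedNotch 5 4) (x := false) (y := false)
    [(0, 2, 0, 1), (0, 0, 0, 1), (2, 0, 2, 1), (0, 1, 1, 1), (2, 1, 1, 1), (0, 3, 1, 3),
      (1, 1, 1, 2), (1, 3, 1, 2), (3, 3, 2, 3), (1, 2, 2, 2), (2, 3, 2, 2), (4, 3, 4, 2),
      (2, 2, 3, 2), (4, 2, 3, 2)]
    (by decide +kernel)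
    (A := trail false n m (m - 4)) (B := clearedNotch n m) ?_ ?_ ?_
  · simpa using h
  all_goals
    rintro ⟨i, k⟩ hp
    simp only [InBox] at hp
    simp only [trail, clearedNotch, Prod.mk.injEq]
    split_ifs <;> first | rfl | (exfalso; omega)

theorem play_trail_true_clearedNotch {n m : ℤ} (hn : 5 ≤ n) (hm : 4 ≤ m) :
    Play (parity (m - 4)) (trail true n m (m - 4)) (parity (m - 4)) (clearedNotch n m) := by
  have h := play_at_column (m - 4) (h := 5) (w := 4) (R := trail true 5 4 0)
    (S := clearedNotch 5 4) (x := false) (y := false)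
    [(0, 0, 0, 1), (0, 3, 0, 2), (0, 1, 0, 2), (4, 3, 3, 3), (1, 1, 2, 1), (2, 0, 2, 1),
      (0, 2, 1, 2), (2, 1, 2, 2), (1, 3, 2, 3), (3, 3, 2, 3), (1, 2, 2, 2), (2, 3, 2, 2),
      (4, 2, 3, 2), (2, 2, 3, 2)]
    (by decide +kernel)
    (A := trail true n m (m - 4)) (B := clearedNotch n m) ?_ ?_ ?_
  · simpa using h
  all_goals
    rintro ⟨i, k⟩ hp
    simp only [InBox] at hp
    simp only [trail, clearedNotch, Prod.mk.injEq]
    split_ifs <;> first | rfl | (exfalso; omega)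

/-- This variant orients the notch so that the next clearing removes columns instead of rows. -/
theorem play_trail_false_clearedNotchTranspose {n m : ℤ} (hn : 5 ≤ n) (hm : 4 ≤ m) :
    Play (parity (m - 4)) (trail false n m (m - 4)) (parity (m - 4)) (clearedNotchTranspose n m) := by
  have h := play_at_column (m - 4) (h := 5) (w := 4) (R := trail false 5 4 0)
    (S := clearedNotchTranspose 5 4) (x := false) (y := false)
    [(1, 3, 1, 2), (0, 3, 0, 2), (1, 2, 0, 2), (2, 3, 3, 3), (0, 2, 0, 1), (0, 0, 0, 1),
      (2, 0, 2, 1), (0, 1, 1, 1), (2, 2, 3, 2), (1, 1, 2, 1), (4, 2, 4, 3), (2, 1, 3, 1),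
      (3, 2, 3, 1), (3, 3, 4, 3)]
    (by decide +kernel)
    (A := trail false n m (m - 4)) (B := clearedNotchTranspose n m) ?_ ?_ ?_
  · simpa using h
  all_goals
    rintro ⟨i, k⟩ hp
    simp only [InBox] at hp
    simp only [trail, clearedNotchTranspose, Prod.mk.injEq]
    split_ifs <;> first | rfl | (exfalso; omega)

theorem play_trail_true_clearedNotchTranspose {n m : ℤ} (hn : 5 ≤ n) (hm : 4 ≤ m) :
    Play (parity (m - 4)) (trail true n m (m - 4)) (parity (m - 4)) (clearedNotchTranspose n m) := by
  have h := play_at_column (m - 4) (h := 5) (w := 4) (R := trail true 5 4 0)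
    (S := clearedNotchTranspose 5 4) (x := false) (y := false)
    [(0, 0, 0, 1), (0, 3, 0, 2), (1, 3, 1, 2), (0, 2, 0, 1), (2, 2, 2, 1), (0, 1, 1, 1),
      (1, 2, 1, 1), (2, 0, 2, 1), (1, 1, 2, 1), (2, 3, 3, 3), (4, 2, 4, 3), (3, 2, 3, 1),
      (2, 1, 3, 1), (3, 3, 4, 3)]
    (by decide +kernel)
    (A := trail true n m (m - 4)) (B := clearedNotchTranspose n m) ?_ ?_ ?_
  · simpa using h
  all_goals
    rintro ⟨i, k⟩ hp
    simp only [InBox] at hp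
    simp only [trail, clearedNotchTranspose, Prod.mk.injEq]
    split_ifs <;> first | rfl | (exfalso; omega)

/-- With four columns the absorption would have to begin at column `0`, before any opening has
produced a trail; hence a separate play. -/
theorem play_rect_clearedNotch {n : ℤ} (hn : 5 ≤ n) :
    Play true (rect n 4) false (clearedNotch n 4) := by
  have h := play_at_origin (h := 5) (w := 4) (R := rect 5 4)
    (S := clearedNotch 5 4) (x := true) (y := false)
    [(0, 1, 0, 2), (0, 0, 1, 0), (2, 1, 2, 0), (1, 3, 0, 3), (2, 0, 1, 0), (0, 3, 0, 2),
      (1, 0, 1, 1), (0, 2, 1, 2), (1, 1, 1, 2), (3, 3, 2, 3), (1, 2, 2, 2), (2, 3, 2, 2),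
      (4, 3, 4, 2), (2, 2, 3, 2), (4, 2, 3, 2)]
    (by decide +kernel)
    (A := rect n 4) (B := clearedNotch n 4) ?_ ?_ ?_
  · simpa using h
  all_goals
    rintro ⟨i, k⟩ hp
    simp only [InBox] at hp
    simp only [rect, clearedNotch]
    split_ifs <;> first | rfl | (exfalso; omega)

theorem play_notch_clearedNotch {n : ℤ} (hn : 5 ≤ n) :
    Play false (notch n 4) false (clearedNotch n 4) := by
  have h := play_at_origin (h := 5) (w := 4) (R := notch 5 4)
    (S := clearedNotch 5 4) (x := false) (y := false)
    [(3, 3, 2, 3), (0, 3, 1, 3), (2, 3, 1, 3), (0, 1, 0, 2), (1, 3, 1, 2), (0, 2, 1, 2),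
      (2, 0, 2, 1), (1, 2, 2, 2), (2, 1, 2, 2), (4, 3, 4, 2), (2, 2, 3, 2), (4, 2, 3, 2)]
    (by decide +kernel)
    (A := notch n 4) (B := clearedNotch n 4) ?_ ?_ ?_
  · simpa using h
  all_goals
    rintro ⟨i, k⟩ hp
    simp only [InBox] at hp
    simp only [notch, clearedNotch]
    split_ifs <;> first | rfl | (exfalso; omega)

/-! ### Boards with at least three rows and columns -/

theorem CanReduce.trail_of_trail {k : ℕ} {b : Bool} {n m j : ℤ} (t : ℕ) (hn : 3 ≤ n) (hj : 0 ≤ j)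
    (hm : j + 2 * t < m) (h : CanReduce k (parity (j + 2 * t)) (trail b n m (j + 2 * t))) :
    CanReduce k (parity j) (trail b n m j) := by
  induction t with
  | zero => simpa using h
  | succ t ih =>
    push_cast at hm h
    apply ih (by omega)
    have hj' : j + 2 * (t + 1 : ℤ) = j + 2 * t + 2 := by ring
    have hp : parity (j + 2 * (t + 1 : ℤ)) = parity (j + 2 * t) := by
      simp only [parity, decide_eq_decide]
      omega
    rw [hp, hj'] at h
    cases b
    · exact h.of_play (play_trail_false hn (by omega) (by omega))
    · exact h.of_play (play_trail_true hn (by omega) (by omega))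

/-- A trail can start in column `1` or `2`, according to the parity of the column `c` where it is
to end. -/
theorem CanReduce.rect_of_trail {k : ℕ} {n m c : ℤ} (hn : 3 ≤ n) (hc : 1 ≤ c) (hcm : c < m)
    (h : ∀ b, CanReduce k (parity c) (trail b n m c)) : CanReduce k true (rect n m) := by
  rcases Int.even_or_odd' c with ⟨d, rfl | rfl⟩
  · have h2 : CanReduce k (parity 2) (trail false n m 2) := by
      -- Here `d` is at least 1 because `1 ≤ c`, so `toNat` truncates nothing: `d - 1` double steps
      -- lead from column `2` to column `2 * d`.
      refine .trail_of_trail (d - 1).toNat hn (by omega) (by omega) ?_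
      have : (2 : ℤ) + 2 * ((d - 1).toNat : ℤ) = 2 * d := by omega
      rw [this]
      exact h false
    exact CanReduce.of_play (y := false) h2 (play_rect_trail_two hn (by omega))
  · have h1 : CanReduce k (parity 1) (trail false n m 1) := by
      refine .trail_of_trail d.toNat hn (by omega) (by omega) ?_
      have : (1 : ℤ) + 2 * (d.toNat : ℤ) = 2 * d + 1 := by omega
      rw [this]
      exact h false
    exact CanReduce.of_play (y := true) h1 (play_rect_trail_one hn (by omega))

theorem CanReduce.notch_of_trail {k : ℕ} {n m c : ℤ} (hn : 3 ≤ n) (hc : 1 ≤ c) (hcm : c < m)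
    (h : ∀ b, CanReduce k (parity c) (trail b n m c)) : CanReduce k false (notch n m) := by
  rcases Int.even_or_odd' c with ⟨d, rfl | rfl⟩
  · have h2 : CanReduce k (parity 2) (trail false n m 2) := by
      refine .trail_of_trail (d - 1).toNat hn (by omega) (by omega) ?_
      have : (2 : ℤ) + 2 * ((d - 1).toNat : ℤ) = 2 * d := by omega
      rw [this]
      exact h false
    exact CanReduce.of_play (y := false) h2 (play_notch_trail_two hn (by omega))
  · have h1 : CanReduce k (parity 1) (trail true n m 1) := by
      refine .trail_of_trail d.toNat hn (by omega) (by omega) ?_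
      have : (1 : ℤ) + 2 * (d.toNat : ℤ) = 2 * d + 1 := by omega
      rw [this]
      exact h true
    exact CanReduce.of_play (y := true) h1 (play_notch_trail_one hn (by omega))

theorem parity_add_sub_one (m : ℤ) : parity (3 + (m - 1)) = parity (m - 4) := by
  simp only [parity, decide_eq_decide]
  omega

/-- The reflection brings the notch to the origin. It shifts colors by the parity of `m - 4`, which
makes Black the player to move there, as at the start of every notched board. -/
theorem CanReduce.clearedNotch {k : ℕ} {n m : ℤ} (h : CanReduce k false (notch (n - 3) m)) :
    CanReduce k (parity (m - 4)) (clearedNotch n m) := by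
  have := h.mirror (A := Clobber.clearedNotch n m) 3 (m - 1) (by
    intro i j
    simp only [Clobber.clearedNotch, notch]
    split_ifs <;> first | rfl | (exfalso; omega))
  rwa [Bool.false_xor, parity_add_sub_one] at this

theorem CanReduce.clearedNotchTranspose {k : ℕ} {n m : ℤ}
    (h : CanReduce k false (notch m (n - 3))) :
    CanReduce k (parity (m - 4)) (clearedNotchTranspose n m) := by
  have h' : CanReduce k false fun p => notch m (n - 3) (p.2, p.1) := h.transpose fun i j => rfl
  have := h'.mirror (A := Clobber.clearedNotchTranspose n m) 3 (m - 1) (by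
    intro i j
    simp only [Clobber.clearedNotchTranspose, notch]
    split_ifs <;> first | rfl | (exfalso; omega))
  rwa [Bool.false_xor, parity_add_sub_one] at this

theorem CanReduce.trail_of_notch {k : ℕ} {n m : ℤ} (hn : 5 ≤ n) (hm : 4 ≤ m)
    (h : CanReduce k false (notch (n - 3) m)) (b : Bool) :
    CanReduce k (parity (m - 4)) (trail b n m (m - 4)) := by
  cases b
  · exact h.clearedNotch.of_play (play_trail_false_clearedNotch hn hm)
  · exact h.clearedNotch.of_play (play_trail_true_clearedNotch hn hm)

theorem CanReduce.trail_of_notch_transpose {k : ℕ} {n m : ℤ} (hn : 5 ≤ n) (hm : 4 ≤ m)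
    (h : CanReduce k false (notch m (n - 3))) (b : Bool) :
    CanReduce k (parity (m - 4)) (trail b n m (m - 4)) := by
  cases b
  · exact h.clearedNotchTranspose.of_play (play_trail_false_clearedNotchTranspose hn hm)
  · exact h.clearedNotchTranspose.of_play (play_trail_true_clearedNotchTranspose hn hm)

theorem CanReduce.rect_of_notch {k : ℕ} {n m : ℤ} (hn : 5 ≤ n) (hm : 4 ≤ m)
    (h : CanReduce k false (notch (n - 3) m)) : CanReduce k true (rect n m) := by
  obtain rfl | hm := hm.eq_or_lt
  · exact CanReduce.of_play (y := false) h.clearedNotch (play_rect_clearedNotch hn)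
  · exact .rect_of_trail (by omega) (by omega) (by omega) (h.trail_of_notch hn hm.le)

theorem CanReduce.notch_of_notch {k : ℕ} {n m : ℤ} (hn : 5 ≤ n) (hm : 4 ≤ m)
    (h : CanReduce k false (notch (n - 3) m)) : CanReduce k false (notch n m) := by
  obtain rfl | hm := hm.eq_or_lt
  · exact CanReduce.of_play (y := false) h.clearedNotch (play_notch_clearedNotch hn)
  · exact .notch_of_trail (by omega) (by omega) (by omega) (h.trail_of_notch hn hm.le)

theorem CanReduce.rect_of_notch_transpose {k : ℕ} {n m : ℤ} (hn : 5 ≤ n) (hm : 5 ≤ m)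
    (h : CanReduce k false (notch m (n - 3))) : CanReduce k true (rect n m) :=
  .rect_of_trail (by omega) (by omega) (by omega) (h.trail_of_notch_transpose hn (by omega))

theorem CanReduce.notch_of_notch_transpose {k : ℕ} {n m : ℤ} (hn : 5 ≤ n) (hm : 5 ≤ m)
    (h : CanReduce k false (notch m (n - 3))) : CanReduce k false (notch n m) :=
  .notch_of_trail (by omega) (by omega) (by omega) (h.trail_of_notch_transpose hn (by omega))

theorem CanReduce.rect_comm {k : ℕ} {x : Bool} {n m : ℤ} (h : CanReduce k x (rect n m)) :
    CanReduce k x (rect m n) := by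
  refine h.transpose fun i j => ?_
  simp only [rect]
  split_ifs <;> first | rfl | (exfalso; omega)

/-! ### Boards with three rows -/

/-- Once the trail reaches the last column of a three-row board, its two stones are all that is
left, and the empty middle row separates them. -/
theorem isTerminal_trail (b : Bool) (m : ℤ) :
    IsTerminal 2 (trail b 3 m (m - 1)) := by
  have h : trail b 3 m (m - 1) = fun p => if p = (0, m - 1) then some b else
      if p = (2, m - 1) then some (!b) else none := by
    funext ⟨i, j⟩
    simp only [trail, Prod.mk.injEq]
    split_ifs <;> first | rfl | (exfalso; omega)
  rw [h]
  exact isTerminal_two (by simp) (by simp [Adjacent]) (by simp [Adjacent])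

theorem canReduce_rect_three {m : ℤ} (hm : 2 ≤ m) : CanReduce 2 true (rect 3 m) :=
  .rect_of_trail le_rfl (c := m - 1) (by omega) (by omega) fun _ =>
    (isTerminal_trail _ _).canReduce

theorem canReduce_notch_three {m : ℤ} (hm : 2 ≤ m) : CanReduce 2 false (notch 3 m) :=
  .notch_of_trail le_rfl (c := m - 1) (by omega) (by omega) fun _ =>
    (isTerminal_trail _ _).canReduce

theorem canReduce_notch_three_mul (q : ℕ) {m : ℤ} (hm : 4 ≤ m) :
    CanReduce 2 false (notch (3 * (q + 1)) m) := by
  induction q with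
  | zero => simpa using canReduce_notch_three (m := m) (by omega)
  | succ q ih =>
    refine .notch_of_notch (by push_cast; omega) hm ?_
    have : 3 * (((q + 1 : ℕ) : ℤ) + 1) - 3 = 3 * (q + 1) := by push_cast; ring
    rwa [this]

theorem canReduce_rect_three_mul (q : ℕ) {m : ℤ} (hm : 3 ≤ m) :
    CanReduce 2 true (rect (3 * (q + 1)) m) := by
  -- Clearing by rows needs four columns; a board with three columns is treated as one with three
  -- rows.
  obtain rfl | hm := hm.eq_or_lt
  · exact (canReduce_rect_three (by omega)).rect_comm
  · cases q with
    | zero => simpa using canReduce_rect_three (m := m) (by omega)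
    | succ q =>
      refine .rect_of_notch (by push_cast; omega) hm ?_
      have : 3 * (((q + 1 : ℕ) : ℤ) + 1) - 3 = 3 * (q + 1) := by push_cast; ring
      rw [this]
      exact canReduce_notch_three_mul q hm

/-! ### Reduction to one stone -/

theorem canReduce_rect_four_four : CanReduce 1 true (rect 4 4) := by
  refine (isTerminal_one _ _).canReduce.of_play (y := false) (S := fun p => if p = (1, 2) then some true else none)
    (play_at_origin (h := 4) (w := 4)
    [(3, 0, 2, 0), (3, 1, 2, 1), (2, 0, 2, 1), (3, 3, 2, 3), (3, 2, 2, 2), (0, 0, 0, 1),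
    (1, 0, 1, 1), (2, 3, 2, 2), (2, 1, 2, 2), (1, 3, 1, 2), (0, 3, 0, 2), (0, 1, 1, 1),
    (2, 2, 1, 2), (1, 1, 1, 2), (0, 2, 1, 2)]
    (by decide +kernel) (fun _ _ => rfl) (fun _ _ => rfl) ?_)
  rintro ⟨i, j⟩ hp
  simp only [InBox] at hp
  simp only [rect, Prod.mk.injEq]
  split_ifs <;> first | rfl | (exfalso; omega)

theorem canReduce_rect_four_five : CanReduce 1 true (rect 4 5) := by
  refine (isTerminal_one _ _).canReduce.of_play (y := false) (S := fun p => if p = (1, 1) then some false else none)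
    (play_at_origin (h := 4) (w := 5)
    [(3, 4, 2, 4), (0, 4, 1, 4), (3, 0, 3, 1), (2, 0, 1, 0), (2, 4, 1, 4), (3, 3, 3, 2),
    (1, 4, 1, 3), (0, 0, 0, 1), (2, 3, 2, 2), (3, 2, 3, 1), (0, 3, 0, 2), (3, 1, 2, 1),
    (2, 2, 2, 1), (0, 1, 0, 2), (2, 1, 1, 1), (0, 2, 1, 2), (1, 3, 1, 2), (1, 0, 1, 1),
    (1, 2, 1, 1)]
    (by decide +kernel) (fun _ _ => rfl) (fun _ _ => rfl) ?_)
  rintro ⟨i, j⟩ hp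
  simp only [InBox] at hp
  simp only [rect, Prod.mk.injEq]
  split_ifs <;> first | rfl | (exfalso; omega)

theorem canReduce_rect_five_five : CanReduce 1 true (rect 5 5) := by
  refine (isTerminal_one _ _).canReduce.of_play (y := true) (S := fun p => if p = (1, 1) then some true else none)
    (play_at_origin (h := 5) (w := 5)
    [(4, 3, 4, 4), (0, 0, 1, 0), (0, 1, 0, 2), (4, 0, 4, 1), (3, 0, 2, 0), (0, 4, 1, 4),
    (0, 3, 1, 3), (1, 4, 1, 3), (2, 0, 1, 0), (1, 3, 1, 2), (2, 1, 3, 1), (2, 4, 3, 4),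
    (4, 4, 3, 4), (4, 2, 3, 2), (3, 4, 3, 3), (4, 1, 3, 1), (3, 3, 3, 2), (3, 1, 3, 2),
    (2, 3, 2, 2), (3, 2, 2, 2), (0, 2, 1, 2), (2, 2, 1, 2), (1, 0, 1, 1), (1, 2, 1, 1)]
    (by decide +kernel) (fun _ _ => rfl) (fun _ _ => rfl) ?_)
  rintro ⟨i, j⟩ hp
  simp only [InBox] at hp
  simp only [rect, Prod.mk.injEq]
  split_ifs <;> first | rfl | (exfalso; omega)

theorem canReduce_notch_four_four : CanReduce 1 false (notch 4 4) := by
  refine (isTerminal_one _ _).canReduce.of_play (y := false) (S := fun p => if p = (3, 2) then some true else none)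
    (play_at_origin (h := 4) (w := 4)
    [(2, 0, 3, 0), (0, 1, 0, 2), (3, 3, 2, 3), (0, 3, 1, 3), (2, 3, 1, 3), (2, 1, 3, 1),
    (1, 3, 1, 2), (0, 2, 1, 2), (3, 0, 3, 1), (1, 2, 2, 2), (3, 1, 3, 2), (2, 2, 3, 2)]
    (by decide +kernel) (fun _ _ => rfl) (fun _ _ => rfl) ?_)
  rintro ⟨i, j⟩ hp
  simp only [InBox] at hp
  simp only [notch, Prod.mk.injEq]
  split_ifs <;> first | rfl | (exfalso; omega)

theorem canReduce_notch_four_five : CanReduce 1 false (notch 4 5) := by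
  refine (isTerminal_one _ _).canReduce.of_play (y := false) (S := fun p => if p = (2, 2) then some false else none)
    (play_at_origin (h := 4) (w := 5)
    [(2, 0, 2, 1), (0, 1, 0, 2), (0, 4, 0, 3), (3, 0, 3, 1), (2, 1, 3, 1), (0, 2, 0, 3),
    (3, 1, 3, 2), (0, 3, 1, 3), (2, 4, 1, 4), (3, 4, 3, 3), (1, 4, 1, 3), (1, 2, 2, 2),
    (1, 3, 2, 3), (3, 3, 3, 2), (2, 3, 2, 2), (3, 2, 2, 2)]
    (by decide +kernel) (fun _ _ => rfl) (fun _ _ => rfl) ?_)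
  rintro ⟨i, j⟩ hp
  simp only [InBox] at hp
  simp only [notch, Prod.mk.injEq]
  split_ifs <;> first | rfl | (exfalso; omega)

theorem canReduce_notch_five_four : CanReduce 1 false (notch 5 4) := by
  refine (isTerminal_one _ _).canReduce.of_play (y := false) (S := fun p => if p = (1, 3) then some false else none)
    (play_at_origin (h := 5) (w := 4)
    [(2, 0, 2, 1), (0, 1, 0, 2), (4, 0, 4, 1), (3, 0, 3, 1), (4, 1, 3, 1), (4, 3, 4, 2),
    (3, 1, 3, 2), (4, 2, 3, 2), (3, 3, 2, 3), (3, 2, 2, 2), (2, 1, 2, 2), (0, 3, 1, 3),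
    (2, 2, 1, 2), (0, 2, 1, 2), (2, 3, 1, 3), (1, 2, 1, 3)]
    (by decide +kernel) (fun _ _ => rfl) (fun _ _ => rfl) ?_)
  rintro ⟨i, j⟩ hp
  simp only [InBox] at hp
  simp only [notch, Prod.mk.injEq]
  split_ifs <;> first | rfl | (exfalso; omega)

theorem canReduce_notch_five_five : CanReduce 1 false (notch 5 5) := by
  refine (isTerminal_one _ _).canReduce.of_play (y := true) (S := fun p => if p = (2, 2) then some true else none)
    (play_at_origin (h := 5) (w := 5)
    [(2, 0, 2, 1), (0, 1, 0, 2), (4, 4, 3, 4), (4, 3, 4, 2), (4, 0, 3, 0), (4, 1, 3, 1),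
    (3, 0, 3, 1), (1, 4, 2, 4), (0, 4, 0, 3), (0, 2, 0, 3), (3, 4, 2, 4), (0, 3, 1, 3),
    (2, 4, 2, 3), (1, 3, 2, 3), (3, 1, 3, 2), (4, 2, 3, 2), (3, 3, 3, 2), (1, 2, 2, 2),
    (2, 1, 2, 2), (2, 3, 2, 2), (3, 2, 2, 2)]
    (by decide +kernel) (fun _ _ => rfl) (fun _ _ => rfl) ?_)
  rintro ⟨i, j⟩ hp
  simp only [InBox] at hp
  simp only [notch, Prod.mk.injEq]
  split_ifs <;> first | rfl | (exfalso; omega)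

/-- The hypothesis `h` excludes boards with `n` in {4, 5} and a longer side `m`: removing three rows
would leave at most two. The induction preserves it by turning the board before this can happen. -/
theorem canReduce_notch_of_not_dvd (N : ℕ) {n m : ℤ} (hN : n + m ≤ N) (hn : 4 ≤ n) (hm : 4 ≤ m)
    (hn3 : ¬ 3 ∣ n) (hm3 : ¬ 3 ∣ m) (h : 7 ≤ n ∨ m ≤ 5) : CanReduce 1 false (notch n m) := by
  induction N using Nat.strong_induction_on generalizing n m with
  | _ N ih =>
    by_cases hn7 : 7 ≤ n
    · by_cases h' : 7 ≤ n - 3 ∨ m ≤ 5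
      · exact .notch_of_notch (by omega) hm
          (ih (N - 3) (by omega) (by omega) (by omega) hm (by omega) hm3 h')
      -- Now `n - 3` is 4 or 5 and `m` is at least 7, so `m` becomes the side to be shortened.
      · exact .notch_of_notch_transpose (by omega) (by omega)
          (ih (N - 3) (by omega) (by omega) hm (by omega) hm3 (by omega) (by omega))
    · obtain rfl | rfl : n = 4 ∨ n = 5 := by omega
      · obtain rfl | rfl : m = 4 ∨ m = 5 := by omega
        · exact canReduce_notch_four_four
        · exact canReduce_notch_four_five
      · obtain rfl | rfl : m = 4 ∨ m = 5 := by omega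
        · exact canReduce_notch_five_four
        · exact canReduce_notch_five_five

theorem canReduce_rect_of_seven_le {n m : ℤ} (hn : 7 ≤ n) (hm : 4 ≤ m) (hn3 : ¬ 3 ∣ n)
    (hm3 : ¬ 3 ∣ m) : CanReduce 1 true (rect n m) := by
  by_cases h' : 7 ≤ n - 3 ∨ m ≤ 5
  · exact .rect_of_notch (by omega) hm
      (canReduce_notch_of_not_dvd (n + m).toNat (by omega) (by omega) hm (by omega) hm3 h')
  · exact .rect_of_notch_transpose (by omega) (by omega)
      (canReduce_notch_of_not_dvd (n + m).toNat (by omega) hm (by omega) hm3 (by omega) (by omega))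

theorem canReduce_rect_of_not_dvd {n m : ℤ} (hn : 4 ≤ n) (hm : 4 ≤ m) (hn3 : ¬ 3 ∣ n)
    (hm3 : ¬ 3 ∣ m) : CanReduce 1 true (rect n m) := by
  by_cases hn7 : 7 ≤ n
  · exact canReduce_rect_of_seven_le hn7 hm hn3 hm3
  by_cases hm7 : 7 ≤ m
  · exact (canReduce_rect_of_seven_le hm7 hn hm3 hn3).rect_comm
  obtain rfl | rfl : n = 4 ∨ n = 5 := by omega
  · obtain rfl | rfl : m = 4 ∨ m = 5 := by omega
    · exact canReduce_rect_four_four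
    · exact canReduce_rect_four_five
  · obtain rfl | rfl : m = 4 ∨ m = 5 := by omega
    · exact canReduce_rect_four_five.rect_comm
    · exact canReduce_rect_five_five

/-! ### Boards with two rows -/

/-- The `2 × m` rectangle after one move in its first and one in its last column: a clashing
stone is left in row `0` of the first and in row `m % 2` of the last column. -/
def ends (m : ℤ) : Board := fun p =>
  if 0 ≤ p.1 ∧ p.1 < 2 ∧ 0 ≤ p.2 ∧ p.2 < m then
    if p.2 = 0 then (if p.1 = 0 then some false else none)
    else if p.2 = m - 1 then (if p.1 = m % 2 then some false else none)
    else some true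
  else none

/-- Three stages of eating three columns at an end of a strip of two rows. -/
def tip (s : ℕ) : Board := fun p =>
  match s with
  | 0 => if p.2 = 0 then (if p.1 = 0 then some false else none) else some true
  | 1 => if 2 ≤ p.2 ∧ p.1 = 0 then some true else none
  | _ => if p.2 = 3 ∧ p.1 = 0 then some false else none

/-- A strip of two rows with the stage `s` at its first four and, turned round, the stage `t` at
its last four columns. -/
def tips (s t : ℕ) (m : ℤ) : Board := fun p =>
  if 0 ≤ p.1 ∧ p.1 < 2 ∧ 0 ≤ p.2 ∧ p.2 < m then
    if p.2 < 4 then tip s p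
    else if m - 4 ≤ p.2 then tip t (if m % 2 = 0 then p.1 else 1 - p.1, m - 1 - p.2)
    else some true
  else none

theorem play_tips_left {s s' : ℕ} {x y : Bool} (l : List Ply)
    (hc : checkPlay 2 4 (tip s') y l x (tip s) = true) (t : ℕ) {m : ℤ} (hm : 8 ≤ m) :
    Play x (tips s t m) y (tips s' t m) := by
  refine play_at_origin l hc ?_ ?_ ?_
  all_goals
    rintro ⟨i, j⟩ hp
    simp only [InBox] at hp
    simp only [tips]
    split_ifs <;> first | rfl | (exfalso; omega)

/-- The symmetry exchanging the two ends (a reflection for even `m`, a half-turn for odd `m`) also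
exchanges the colors, so the play at the left end becomes one with the players interchanged. -/
theorem play_tips_right {t t' : ℕ} {x y : Bool} (l : List Ply)
    (hc : checkPlay 2 4 (tip t') y l x (tip t) = true) (s : ℕ) {m : ℤ} (hm : 8 ≤ m) :
    Play (!x) (tips s t m) (!y) (tips s t' m) := by
  by_cases hpar : m % 2 = 0
  · have h1 : parity (0 + (m - 1)) = true := by
      simp only [parity, decide_eq_true_eq]
      omega
    have := play_of_checkPlay l hc (isSymmetry_mirror 0 (m - 1)) (A := tips s t m)
      (B := tips s t' m) ?_ ?_ ?_
    · rw [h1] at this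
      simpa using this
    all_goals
      rintro ⟨i, j⟩ hp
      simp only [InBox] at hp
      simp only [mirror, Equiv.coe_fn_mk, tips, hpar, if_true, sub_sub_cancel, add_zero]
      split_ifs <;> first | rfl | (exfalso; omega)
  · have h1 : parity (1 + (m - 1)) = true := by
      simp only [parity, decide_eq_true_eq]
      omega
    have := play_of_checkPlay l hc (isSymmetry_halfTurn 1 (m - 1)) (A := tips s t m)
      (B := tips s t' m) ?_ ?_ ?_
    · rw [h1] at this
      simpa using this
    all_goals
      rintro ⟨i, j⟩ hp
      simp only [InBox] at hp
      simp only [halfTurn, Equiv.coe_fn_mk, tips, hpar, if_false, sub_sub_cancel]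
      split_ifs <;> first | rfl | (exfalso; omega)

theorem checkPlay_tip_zero :
    checkPlay 2 4 (tip 1) true
      [(1, 1, 0, 1), (0, 0, 0, 1), (1, 3, 1, 2), (0, 1, 0, 2), (1, 2, 0, 2)] false (tip 0) =
      true := by
  decide +kernel

theorem checkPlay_tip_one : checkPlay 2 4 (tip 2) true [(0, 2, 0, 3)] false (tip 1) = true := by
  decide +kernel

/-- Both stages have an odd number of moves, five and one. After each of them at the left end it is
White's turn, as the color-exchanged copy at the right end requires, and then Black's again. -/
theorem play_tips {m : ℤ} (hm : 8 ≤ m) : Play false (tips 0 0 m) false (tips 2 2 m) :=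
  ((play_tips_left _ checkPlay_tip_zero 0 hm).trans
    (play_tips_right _ checkPlay_tip_zero 1 hm)).trans
  ((play_tips_left _ checkPlay_tip_one 1 hm).trans (play_tips_right _ checkPlay_tip_one 2 hm))

theorem tips_zero_zero {m : ℤ} (hm : 8 ≤ m) : tips 0 0 m = ends m := by
  funext ⟨i, j⟩
  simp only [tips, tip, ends]
  split_ifs <;> first | rfl | (exfalso; omega)

/-- A shift by three columns would exchange the colors, so the shorter strip is also turned round,
which restores Black as the player to move. -/
theorem CanReduce.tips_of_ends {k : ℕ} {m : ℤ} (hm : 8 ≤ m)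
    (h : CanReduce k false (ends (m - 6))) : CanReduce k false (tips 2 2 m) := by
  by_cases hpar : m % 2 = 0
  · have h1 : parity (0 + (m - 4)) = false := by
      simp only [parity, decide_eq_false_iff_not]
      omega
    have := h.mirror (A := tips 2 2 m) 0 (m - 4) ?_
    · rw [h1] at this
      simpa using this
    · intro i j
      simp only [tips, tip, ends]
      split_ifs <;> first | rfl | (exfalso; omega)
  · have h1 : parity (1 + (m - 4)) = false := by
      simp only [parity, decide_eq_false_iff_not]
      omega
    have := h.halfTurn (A := tips 2 2 m) 1 (m - 4) ?_
    · rw [h1] at this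
      simpa using this
    · intro i j
      simp only [tips, tip, ends]
      split_ifs <;> first | rfl | (exfalso; omega)

theorem CanReduce.ends_of_ends {k : ℕ} {m : ℤ} (hm : 8 ≤ m)
    (h : CanReduce k false (ends (m - 6))) : CanReduce k false (ends m) := by
  rw [← tips_zero_zero hm]
  exact (CanReduce.tips_of_ends hm h).of_play (play_tips hm)

theorem canReduce_ends_two : CanReduce 1 false (ends 2) := by
  refine (isTerminal_one _ _).canReduce.of_play (y := true) (S := fun p => if p = (0, 0) then some true else none)
    (play_at_origin (h := 2) (w := 2)
    [(0, 1, 0, 0)]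
    (by decide +kernel) (fun _ _ => rfl) (fun _ _ => rfl) ?_)
  rintro ⟨i, j⟩ hp
  simp only [InBox] at hp
  simp only [ends, Prod.mk.injEq]
  split_ifs <;> first | rfl | (exfalso; omega)

theorem canReduce_ends_three : CanReduce 2 false (ends 3) := by
  refine (isTerminal_two (by simp) (by simp [Adjacent]) (by simp [Adjacent])).canReduce.of_play (y := false) (S := fun p => if p = (0, 1) then some true else
      if p = (1, 2) then some false else none)
    (play_at_origin (h := 2) (w := 3)
    [(1, 1, 0, 1), (0, 0, 0, 1)]
    (by decide +kernel) (fun _ _ => rfl) (fun _ _ => rfl) ?_)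
  rintro ⟨i, j⟩ hp
  simp only [InBox] at hp
  simp only [ends, Prod.mk.injEq]
  split_ifs <;> first | rfl | (exfalso; omega)

theorem canReduce_ends_four : CanReduce 1 false (ends 4) := by
  refine (isTerminal_one _ _).canReduce.of_play (y := true) (S := fun p => if p = (0, 1) then some false else none)
    (play_at_origin (h := 2) (w := 4)
    [(1, 1, 0, 1), (1, 2, 0, 2), (0, 3, 0, 2), (0, 0, 0, 1), (0, 2, 0, 1)]
    (by decide +kernel) (fun _ _ => rfl) (fun _ _ => rfl) ?_)
  rintro ⟨i, j⟩ hp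
  simp only [InBox] at hp
  simp only [ends, Prod.mk.injEq]
  split_ifs <;> first | rfl | (exfalso; omega)

theorem canReduce_ends_five : CanReduce 1 false (ends 5) := by
  refine (isTerminal_one _ _).canReduce.of_play (y := true) (S := fun p => if p = (1, 1) then some true else none)
    (play_at_origin (h := 2) (w := 5)
    [(0, 2, 0, 1), (0, 3, 1, 3), (1, 4, 1, 3), (0, 0, 0, 1), (1, 3, 1, 2), (0, 1, 1, 1),
    (1, 2, 1, 1)]
    (by decide +kernel) (fun _ _ => rfl) (fun _ _ => rfl) ?_)
  rintro ⟨i, j⟩ hp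
  simp only [InBox] at hp
  simp only [ends, Prod.mk.injEq]
  split_ifs <;> first | rfl | (exfalso; omega)

theorem canReduce_ends_six : CanReduce 2 false (ends 6) := by
  refine (isTerminal_two (by simp) (by simp [Adjacent]) (by simp [Adjacent])).canReduce.of_play (y := false) (S := fun p => if p = (0, 0) then some true else
      if p = (0, 4) then some false else none)
    (play_at_origin (h := 2) (w := 6)
    [(0, 2, 0, 3), (1, 2, 1, 3), (1, 1, 0, 1), (1, 3, 0, 3), (0, 1, 0, 0), (0, 3, 0, 4),
    (0, 5, 0, 4), (1, 4, 0, 4)]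
    (by decide +kernel) (fun _ _ => rfl) (fun _ _ => rfl) ?_)
  rintro ⟨i, j⟩ hp
  simp only [InBox] at hp
  simp only [ends, Prod.mk.injEq]
  split_ifs <;> first | rfl | (exfalso; omega)

theorem canReduce_ends_seven : CanReduce 1 false (ends 7) := by
  refine (isTerminal_one _ _).canReduce.of_play (y := true) (S := fun p => if p = (0, 3) then some false else none)
    (play_at_origin (h := 2) (w := 7)
    [(0, 4, 0, 3), (0, 5, 1, 5), (1, 1, 0, 1), (0, 0, 0, 1), (1, 6, 1, 5), (0, 1, 0, 2),
    (1, 5, 1, 4), (1, 2, 1, 3), (1, 4, 1, 3), (0, 2, 0, 3), (1, 3, 0, 3)]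
    (by decide +kernel) (fun _ _ => rfl) (fun _ _ => rfl) ?_)
  rintro ⟨i, j⟩ hp
  simp only [InBox] at hp
  simp only [ends, Prod.mk.injEq]
  split_ifs <;> first | rfl | (exfalso; omega)

/-- The number of stones to which a rectangle of `N` squares can be reduced. -/
def residue (N : ℤ) : ℕ := if 3 ∣ N then 2 else 1

theorem canReduce_ends (N : ℕ) {m : ℤ} (hN : m ≤ N) (hm : 2 ≤ m) :
    CanReduce (residue m) false (ends m) := by
  induction N using Nat.strong_induction_on generalizing m with
  | _ N ih =>
    by_cases h8 : 8 ≤ m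
    · refine .ends_of_ends h8 ?_
      have h : residue m = residue (m - 6) := by
        simp only [residue]
        congr 1
        rw [eq_iff_iff]
        omega
      rw [h]
      exact ih (N - 6) (by omega) (by omega) (by omega)
    · obtain rfl | rfl | rfl | rfl | rfl | rfl :
        m = 2 ∨ m = 3 ∨ m = 4 ∨ m = 5 ∨ m = 6 ∨ m = 7 := by omega
      · exact canReduce_ends_two
      · exact canReduce_ends_three
      · exact canReduce_ends_four
      · exact canReduce_ends_five
      · exact canReduce_ends_six
      · exact canReduce_ends_seven

theorem play_rect_ends {m : ℤ} (hm : 2 ≤ m) : Play false (rect 2 m) false (ends m) := by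
  have h0 : m % 2 = 0 ∨ m % 2 = 1 := by omega
  -- The coordinate sum `m - m % 2` is even, so this stone is black; the stone on `(1, 0)` moved
  -- next is white.
  refine .step (p := (1 - m % 2, m - 1)) (q := (m % 2, m - 1)) ⟨?_, true, ?_, ?_, ?_⟩
    (.step (p := (1, 0)) (q := (0, 0)) ⟨?_, true, ?_, ?_, ?_⟩ ?_)
  · rcases h0 with h | h <;> simp [Adjacent, h]
  · simp only [rect]
    rw [if_pos (by omega)]
  · simp only [rect]
    rw [if_pos (by omega)]
  · simp only [colorBit, parity, Bool.not_true, Bool.xor_false, decide_eq_false_iff_not]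
    omega
  · simp [Adjacent]
  · simp only [Board.clobber, Function.update_apply, rect, Prod.mk.injEq]
    split_ifs <;> first | rfl | (exfalso; omega)
  · simp only [Board.clobber, Function.update_apply, rect, Prod.mk.injEq]
    split_ifs <;> first | rfl | (exfalso; omega)
  · simp [colorBit, parity]
  · have : Board.clobber (Board.clobber (rect 2 m) (1 - m % 2, m - 1) (m % 2, m - 1)) (1, 0)
        (0, 0) = ends m := by
      funext ⟨i, j⟩
      simp only [Board.clobber, Function.update_apply, rect, ends, Prod.mk.injEq]
      split_ifs <;> first | rfl | (exfalso; omega)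
    rw [this]
    exact .refl _ _

/-- A two-row rectangle has a symmetry onto itself that exchanges the colors, so it does not matter
that `play_rect_ends` lets Black start. -/
theorem canReduce_rect_two {m : ℤ} (hm : 2 ≤ m) : CanReduce (residue m) true (rect 2 m) := by
  have h := (canReduce_ends m.toNat (by omega) hm).of_play (play_rect_ends hm)
  by_cases hpar : m % 2 = 0
  · have h1 : parity (0 + (m - 1)) = true := by
      simp only [parity, decide_eq_true_eq]
      omega
    have := h.mirror (A := rect 2 m) 0 (m - 1) ?_
    · rwa [h1] at this
    · intro i j
      simp only [rect]
      split_ifs <;> first | rfl | (exfalso; omega)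
  · have h1 : parity (1 + (m - 1)) = true := by
      simp only [parity, decide_eq_true_eq]
      omega
    have := h.halfTurn (A := rect 2 m) 1 (m - 1) ?_
    · rwa [h1] at this
    · intro i j
      simp only [rect]
      split_ifs <;> first | rfl | (exfalso; omega)

theorem canReduce_rect_of_dvd {n m : ℤ} (hn : 3 ≤ n) (hm : 3 ≤ m) (h : 3 ∣ n) :
    CanReduce 2 true (rect n m) := by
  obtain ⟨q, rfl⟩ := h
  have : (3 : ℤ) * q = 3 * (((q - 1).toNat : ℤ) + 1) := by omega
  rw [this]
  exact canReduce_rect_three_mul _ hm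

theorem residue_two_mul (m : ℤ) : residue (2 * m) = residue m := by
  simp only [residue]
  congr 1
  rw [eq_iff_iff]
  omega

theorem canReduce_rect {n m : ℤ} (hn : 2 ≤ n) (hm : 2 ≤ m) :
    CanReduce (residue (n * m)) true (rect n m) := by
  obtain rfl | hn := hn.eq_or_lt
  · rw [residue_two_mul]
    exact canReduce_rect_two hm
  obtain rfl | hm := hm.eq_or_lt
  · rw [mul_comm, residue_two_mul]
    exact (canReduce_rect_two hn.le).rect_comm
  by_cases h : 3 ∣ n * m
  · rw [residue, if_pos h]
    rcases Int.prime_three.dvd_mul.1 h with h | h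
    · exact canReduce_rect_of_dvd hn hm h
    · exact (canReduce_rect_of_dvd hm hn h).rect_comm
  · rw [residue, if_neg h]
    have hn3 : ¬ 3 ∣ n := fun h' => h (h'.mul_right m)
    have hm3 : ¬ 3 ∣ m := fun h' => h (h'.mul_left n)
    exact canReduce_rect_of_not_dvd (by omega) (by omega) hn3 hm3

/-! ### Configurations and boards -/

/-- The color that a bit stands for. -/
def colorOfBit (b : Bool) : Color := if b then Color.white else Color.black

/-- The stone of state `b` on `p`, as a color. -/
def stoneColor (p : Square) (b : Bool) : Color := colorOfBit (colorBit p b)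

/-- The configuration that a relative board describes. -/
def toConfig (R : Board) : Config := fun p => (R p).map (stoneColor p)

theorem colorOfBit_not (b : Bool) : colorOfBit (!b) = (colorOfBit b).other := by
  cases b <;> rfl

theorem stoneColor_true (p : Square) : stoneColor p true = squareColor p := by
  unfold stoneColor squareColor colorBit parity colorOfBit
  by_cases h : Even (p.1 + p.2)
  · have := Int.even_iff.1 h
    simp [h, this]
  · have := Int.not_even_iff.1 h
    simp [h, this]

theorem parity_of_adjacent {p q : Square} (h : Adjacent p q) :
    parity (q.1 + q.2) = !parity (p.1 + p.2) := by
  simp only [Adjacent] at h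
  have : parity (q.1 + q.2) = xor (parity (p.1 + p.2)) true := by
    rw [parity_eq_xor_iff]
    simp only [if_true]
    rcases abs_cases (p.1 - q.1) with ⟨h1, -⟩ | ⟨h1, -⟩ <;>
      rcases abs_cases (p.2 - q.2) with ⟨h2, -⟩ | ⟨h2, -⟩ <;> omega
  simpa using this

theorem colorBit_of_adjacent {p q : Square} (h : Adjacent p q) (b : Bool) :
    colorBit q b = !colorBit p b := by
  simp only [colorBit, parity_of_adjacent h]
  cases parity (p.1 + p.2) <;> cases b <;> rfl

theorem colorBit_not (p : Square) (b : Bool) : colorBit p (!b) = !colorBit p b := by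
  simp only [colorBit]
  cases parity (p.1 + p.2) <;> cases b <;> rfl

theorem move_toConfig {x : Bool} {R : Board} {p q : Square} (h : CanClobber x R p q) :
    Move (colorOfBit x) (toConfig R) (toConfig (R.clobber p q)) := by
  obtain ⟨hadj, b, hb, hb', rfl⟩ := h
  refine ⟨p, q, hadj, ?_, ?_, ?_⟩
  · simp [toConfig, hb, stoneColor]
  · simp [toConfig, hb', stoneColor, colorBit_of_adjacent hadj, colorOfBit_not]
  · funext r
    by_cases h1 : r = q
    · subst h1
      simp [toConfig, Board.clobber, hb', stoneColor, colorBit_of_adjacent hadj, colorBit_not]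
    · by_cases h2 : r = p
      · subst h2
        simp [toConfig, Board.clobber, h1]
      · simp [toConfig, Board.clobber, h1, h2]

theorem alternating_toConfig {x y : Bool} {R S : Board} (h : Play x R y S) :
    Alternating (colorOfBit x) (toConfig R) (toConfig S) := by
  induction h with
  | refl => exact .refl _ _
  | step hc _ ih =>
    rw [colorOfBit_not] at ih
    exact .step (move_toConfig hc) ih

theorem stuck_toConfig {R : Board}
    (h : ∀ p q b, Adjacent p q → R p = some b → R q ≠ some b) : Stuck (toConfig R) := by
  rintro c D ⟨p, q, hadj, hp, hq, -⟩
  simp only [toConfig, Option.map_eq_some_iff] at hp hq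
  obtain ⟨b, hb, rfl⟩ := hp
  obtain ⟨b', hb', h'⟩ := hq
  have : b' = b := by
    simp only [stoneColor, colorBit_of_adjacent hadj, ← colorOfBit_not] at h'
    simp only [colorBit] at h'
    generalize parity (p.1 + p.2) = z at h'
    revert h'
    cases b <;> cases b' <;> cases z <;> simp [colorOfBit]
  subst this
  exact h p q _ hadj hb hb'

theorem CanReduce.reducible {k : ℕ} {R : Board} (h : CanReduce k true R) :
    Reducible (toConfig R) k := by
  obtain ⟨y, S, hp, hk, hs⟩ := h
  refine ⟨_, alternating_toConfig hp, stuck_toConfig hs, ?_⟩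
  rw [← hk]
  congr 1
  ext p
  simp [stones, toConfig]

/-! ### The invariant modulo three -/

/-- The weight of what lies on a square: `1` for a matching and `2` for a clashing stone. -/
def weight (p : Square) (o : Option Color) : ZMod 3 :=
  match o with
  | none => 0
  | some c => if c = squareColor p then 1 else 2

theorem weight_move {p q : Square} (h : Adjacent p q) (c : Color) :
    weight p (some c) + weight q (some c.other) = weight q (some c) := by
  have hs : squareColor q = (squareColor p).other := by
    rw [← stoneColor_true, ← stoneColor_true]
    simp only [stoneColor, colorBit_of_adjacent h, colorOfBit_not]
  simp only [weight, hs]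
  generalize squareColor p = d
  cases c <;> cases d <;> decide

/-- Moves never occupy an empty square, so one finite set carries the weight sum through a whole
play. -/
theorem sum_weight_of_move {c : Color} {C D : Config} (h : Move c C D) {s : Finset Square}
    (hs : stones C ⊆ s) :
    stones D ⊆ s ∧ ∑ p ∈ s, weight p (D p) = ∑ p ∈ s, weight p (C p) := by
  obtain ⟨p, q, hadj, hp, hq, rfl⟩ := h
  have hne : p ≠ q := by
    rintro rfl
    simp [Adjacent] at hadj
  have hps : p ∈ s := hs (by simp [stones, hp])
  have hqs : q ∈ s := hs (by simp [stones, hq])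
  constructor
  · intro r hr
    by_cases h1 : r = q
    · rwa [h1]
    · by_cases h2 : r = p
      · rwa [h2]
      · exact hs (by simpa [stones, h1, h2] using hr)
  · have hq' : q ∈ s.erase p := Finset.mem_erase.2 ⟨hne.symm, hqs⟩
    rw [← Finset.add_sum_erase _ _ hps, ← Finset.add_sum_erase _ _ hq',
      ← Finset.add_sum_erase s (fun r => weight r (C r)) hps,
      ← Finset.add_sum_erase _ (fun r => weight r (C r)) hq', ← add_assoc, ← add_assoc]
    congr 1
    · simp only [Function.update_self, Function.update_of_ne hne, hp, hq]
      rw [weight_move hadj]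
      simp [weight]
    · refine Finset.sum_congr rfl fun r hr => ?_
      simp only [Finset.mem_erase] at hr
      simp [hr.1, hr.2.1]

theorem sum_weight_of_reachable {C D : Config} (h : Reachable C D) {s : Finset Square}
    (hs : stones C ⊆ s) :
    stones D ⊆ s ∧ ∑ p ∈ s, weight p (D p) = ∑ p ∈ s, weight p (C p) := by
  induction h with
  | refl => exact ⟨hs, rfl⟩
  | tail _ hm ih =>
    obtain ⟨c, hm⟩ := hm
    obtain ⟨h1, h2⟩ := sum_weight_of_move hm ih.1
    exact ⟨h1, h2.trans ih.2⟩

theorem Alternating.reachable {c : Color} {C D : Config} (h : Alternating c C D) :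
    Reachable C D := by
  induction h with
  | refl => exact .refl
  | step hm _ ih => exact .head ⟨_, hm⟩ ih

theorem Reducible.freelyReducible {C : Config} {k : ℕ} (h : Reducible C k) :
    FreelyReducible C k := by
  obtain ⟨D, h1, h2⟩ := h
  exact ⟨D, h1.reachable, h2⟩

theorem not_freelyReducible_one {C : Config} {s : Finset Square} (hs : stones C = s)
    (hcheck : IsCheckerboard C) (h3 : 3 ∣ s.card) : ¬ FreelyReducible C 1 := by
  rintro ⟨D, hD, -, h1⟩
  obtain ⟨hsub, hsum⟩ := sum_weight_of_reachable hD hs.subset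
  obtain ⟨a, ha⟩ := Set.encard_eq_one.1 (by simpa using h1)
  have hC : ∑ p ∈ s, weight p (C p) = 0 := by
    have : ∀ p ∈ s, weight p (C p) = 1 := by
      intro p hp
      have hp' : p ∈ stones C := by rwa [hs]
      obtain ⟨c, hc⟩ := Option.ne_none_iff_exists'.1 hp'
      simp [weight, hc, hcheck p c hc]
    rw [Finset.sum_congr rfl this, Finset.sum_const, nsmul_one]
    exact (ZMod.natCast_eq_zero_iff _ _).2 h3
  have haD : a ∈ stones D := by simp [ha]
  have hDa : ∑ p ∈ s, weight p (D p) = weight a (D a) := by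
    refine Finset.sum_eq_single_of_mem a (hsub haD) fun p _ hpa => ?_
    have : p ∉ stones D := by simpa [ha] using hpa
    have : D p = none := by simpa [stones] using this
    simp [weight, this]
  obtain ⟨c, hc⟩ := Option.ne_none_iff_exists'.1 haD
  rw [hDa, hC, hc] at hsum
  simp only [weight] at hsum
  split_ifs at hsum <;> exact absurd hsum (by decide)

/-! ### The theorem -/

theorem eq_toConfig_of_isCheckerboard {C : Config} (hcheck : IsCheckerboard C) :
    C = toConfig fun p => if C p = none then none else some true := by
  funext p
  cases hc : C p with
  | none => simp [toConfig, hc]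
  | some c => simp [toConfig, hc, stoneColor_true, hcheck p c hc]

/-- If both sides of a rectangle are odd and it starts with a white square, then it has more white
than black squares. -/
theorem black_lt_white {C : Config} {a b : ℤ} {n m : ℕ} (hn : n % 2 = 1) (hm : m % 2 = 1)
    (hC : stones C = {p | (a ≤ p.1 ∧ p.1 < a + n) ∧ (b ≤ p.2 ∧ p.2 < b + m)})
    (hcheck : IsCheckerboard C) (hab : (a + b) % 2 = 1) :
    (stonesOf Color.black C).encard < (stonesOf Color.white C).encard := by
  have hmem : ∀ p c, C p = some c ↔
      ((a ≤ p.1 ∧ p.1 < a + n) ∧ (b ≤ p.2 ∧ p.2 < b + m)) ∧ c = squareColor p := by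
    intro p c
    have hp : C p ≠ none ↔ ((a ≤ p.1 ∧ p.1 < a + n) ∧ (b ≤ p.2 ∧ p.2 < b + m)) :=
      Set.ext_iff.1 hC p
    rw [← hp]
    constructor
    · intro h
      exact ⟨by simp [h], hcheck p c h⟩
    · rintro ⟨h, rfl⟩
      obtain ⟨c, hc⟩ := Option.ne_none_iff_exists'.1 h
      rw [hc, hcheck p c hc]
  have hblack : ∀ p, Color.black = squareColor p ↔ (p.1 + p.2) % 2 = 0 := by
    intro p
    rw [← Int.even_iff]
    by_cases h : Even (p.1 + p.2) <;> simp [squareColor, h]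
  have hwhite : ∀ p, Color.white = squareColor p ↔ (p.1 + p.2) % 2 = 1 := by
    intro p
    rw [← Int.not_even_iff]
    by_cases h : Even (p.1 + p.2) <;> simp [squareColor, h]
  have hfin : (stonesOf Color.white C).Finite := by
    refine ((Set.finite_Icc a (a + n)).prod (Set.finite_Icc b (b + m))).subset ?_
    intro p hp
    have := ((hmem p _).1 hp).1
    simp only [Set.mem_prod, Set.mem_Icc]
    omega
  -- The successor in row-by-row order. As `m` is odd, passing to the next row changes the color of
  -- the square too.
  let f : Square → Square := fun p => if p.2 = b + m - 1 then (p.1 + 1, b) else (p.1, p.2 + 1)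
  have hf : Set.InjOn f (stonesOf Color.black C) := by
    rintro ⟨i, j⟩ hp ⟨k, l⟩ hq hpq
    have h1 := ((hmem _ _).1 hp).1
    have h2 := ((hmem _ _).1 hq).1
    simp only [f] at hpq h1 h2
    split_ifs at hpq <;> simp only [Prod.mk.injEq] at hpq ⊢ <;> omega
  have himage : f '' stonesOf Color.black C ⊂ stonesOf Color.white C := by
    rw [Set.ssubset_iff_of_subset]
    -- The first square is white and has no predecessor in this order.
    · refine ⟨(a, b), (hmem _ _).2 ⟨by simp only; omega, (hwhite _).2 hab⟩, ?_⟩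
      rintro ⟨⟨i, j⟩, hp, hpf⟩
      have h1 := ((hmem _ _).1 hp).1
      simp only [f] at hpf h1
      split_ifs at hpf <;> simp only [Prod.mk.injEq] at hpf <;> omega
    -- The last square is white since both sides are odd, so no black square is sent outside the
    -- rectangle.
    · rintro _ ⟨⟨i, j⟩, hp, rfl⟩
      obtain ⟨h1, h2⟩ := (hmem _ _).1 hp
      rw [hblack] at h2
      simp only at h1 h2
      refine (hmem _ _).2 ⟨?_, (hwhite _).2 ?_⟩
      · simp only [f]
        split_ifs <;> simp only <;> omega
      · simp only [f]
        split_ifs <;> simp only <;> omega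
  rw [← hf.encard_image]
  exact (hfin.subset himage.subset).encard_lt_encard himage

/-- The model `rect n m` has a black square at the origin, so some corner of the given rectangle
must be black. If the first one is white, an even side provides another; if both sides are odd, all
four are white and `hcount` fails. -/
theorem reducible_residue {n m : ℕ} (hn : 2 ≤ n) (hm : 2 ≤ m) {C : Config}
    (hrect : IsRectangular n m C) (hcheck : IsCheckerboard C)
    (hcount : (stonesOf Color.white C).encard ≤ (stonesOf Color.black C).encard) :
    Reducible C (residue (n * m)) := by
  obtain ⟨a, b, hC⟩ := hrect
  have hnone : ∀ p, C p = none ↔ ¬ ((a ≤ p.1 ∧ p.1 < a + n) ∧ (b ≤ p.2 ∧ p.2 < b + m)) := by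
    intro p
    have : C p ≠ none ↔ _ := Set.ext_iff.1 hC p
    rw [← not_iff_not, not_not]
    exact this
  have h := canReduce_rect (n := n) (m := m) (by omega) (by omega)
  rw [eq_toConfig_of_isCheckerboard hcheck]
  apply CanReduce.reducible
  by_cases hab : (a + b) % 2 = 0
  · have := h.shift (A := fun p => if C p = none then none else some true) a b (by
      intro i j
      simp only [hnone, rect]
      split_ifs <;> first | rfl | (exfalso; omega))
    rwa [show parity (a + b) = false by simp [parity, hab], Bool.xor_false] at this
  by_cases hm2 : m % 2 = 0
  · have := h.mirror (A := fun p => if C p = none then none else some true) a (b + m - 1) (by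
      intro i j
      simp only [hnone, rect]
      split_ifs <;> first | rfl | (exfalso; omega))
    rwa [show parity (a + (b + m - 1)) = false by
      simp only [parity, decide_eq_false_iff_not]; omega, Bool.xor_false] at this
  by_cases hn2 : n % 2 = 0
  · have := h.halfTurn (A := fun p => if C p = none then none else some true) (a + n - 1)
      (b + m - 1) (by
        intro i j
        simp only [hnone, rect]
        split_ifs <;> first | rfl | (exfalso; omega))
    rwa [show parity (a + n - 1 + (b + m - 1)) = false by
      simp only [parity, decide_eq_false_iff_not]; omega, Bool.xor_false] at this
  · exact absurd hcount (not_le.2 (black_lt_white (by omega) (by omega) hC hcheck (by omega)))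

end Clobber

theorem theorem6 (n m : ℕ) (hn : 2 ≤ n) (hm : 2 ≤ m) (C : Clobber.Config)
    (hrect : Clobber.IsRectangular n m C) (hcheck : Clobber.IsCheckerboard C)
    (hcount : (Clobber.stonesOf Clobber.Color.white C).encard ≤
      (Clobber.stonesOf Clobber.Color.black C).encard) :
    (¬ 3 ∣ n * m → Clobber.Reducible C 1) ∧
    (3 ∣ n * m →
      Clobber.Reducible C 2 ∧ ¬ Clobber.Reducible C 1 ∧ ¬ Clobber.FreelyReducible C 1) := by
  have hred := Clobber.reducible_residue hn hm hrect hcheck hcount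
  have hdvd : (3 : ℤ) ∣ (n : ℤ) * m ↔ 3 ∣ n * m := by exact_mod_cast Int.natCast_dvd_natCast
  refine ⟨fun h => ?_, fun h => ?_⟩
  · rwa [Clobber.residue, if_neg (mt hdvd.1 h)] at hred
  · rw [Clobber.residue, if_pos (hdvd.2 h)] at hred
    have hfree : ¬ Clobber.FreelyReducible C 1 := by
      obtain ⟨a, b, hC⟩ := hrect
      refine Clobber.not_freelyReducible_one
        (s := Finset.Ico a (a + n) ×ˢ Finset.Ico b (b + m)) ?_ hcheck (by simpa using h)
      rw [hC]
      ext p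
      simp
    exact ⟨hred, fun h' => hfree h'.freelyReducible, hfree⟩
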